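/- Let $\mathbb{D}$ be the open unit disc, $\mathbb{T}$ the unit circle with normalised Lebesgue measure, and let $H^2$ denote the Hardy space, regarded as the closed subspace of $L^2(\mathbb{T})$ of functions whose Fourier coefficients of negative index vanish. An inner function is a bounded analytic function on $\mathbb{D}$ whose radial limits have modulus $1$ almost everywhere on $\mathbb{T}$; it is identified with its boundary function in $L^\infty(\mathbb{T})$. For inner functions $u,v$ we say that $u$ divides $v$ if $v=uw$ on $\mathbb{D}$ for some inner function $w$. A bounded operator $T$ on a Hilbert space is a partial isometry if $\|Th\|=\|h\|$ for all $h\in\mathcal{N}(T)^\perp$. Let $\theta$ be a non-constant inner function, let $K_\theta=H^2\ominus\theta H^2$ and $K_\theta^\perp=L^2(\mathbb{T})\ominus K_\theta$, and let $P_\theta$, $Q_\theta$ be the orthogonal projections of $L^2(\mathbb{T})$ onto $K_\theta$ and $K_\theta^\perp$. For an inner function $u$ let $A_u f=P_\theta(uf)$ $(f\in K_\theta)$ be the truncated Toeplitz operator on $K_\theta$, and let $D_u f=Q_\theta(uf)$ $(f\in K_\theta^\perp)$ be the dual truncated Toeplitz operator on $K_\theta^\perp$. Then, for every inner function $u$,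 the operator $D_u$ is a partial isometry if and only if $u$ divides $\theta$ or $\theta$ divides $u$. Likewise, $A_u$ is a partial isometry if and only if $u$ divides $\theta$ or $\theta$ divides $u$. -/

import Mathlib

open MeasureTheory Filter Topology
open scoped ENNReal

noncomputable section

namespace DualTTO

/-! ### The circle, `L²` and `L^∞` -/

/-- The unit circle `𝕋`, parametrised by `t ↦ exp (i t)`, `t ∈ ℝ / 2πℤ`. -/
abbrev Torus : Type := AddCircle (2 * Real.pi)

instance instFactTwoPiPos : Fact (0 < 2 * Real.pi) := ⟨Real.two_pi_pos⟩

/-- Normalised Lebesgue measure on `𝕋`. -/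
abbrev torusMeasure : Measure Torus := AddCircle.haarAddCircle

/-- `L²(𝕋)`. -/
abbrev L2 : Type := Lp ℂ 2 torusMeasure

/-- `L^∞(𝕋)`. -/
abbrev LInf : Type := Lp ℂ ∞ torusMeasure

/-- The Laurent operator `M_φ f = φ f` on `L²(𝕋)`, for `φ ∈ L^∞(𝕋)`. -/
def laurent (φ : LInf) : L2 →L[ℂ] L2 :=
  (ContinuousLinearMap.mul ℂ ℂ).holderL torusMeasure ∞ 2 2 φ

theorem laurent_coeFn (φ : LInf) (f : L2) :
    laurent φ f =ᵐ[torusMeasure] fun t => φ t * f t :=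
  (ContinuousLinearMap.mul ℂ ℂ).coeFn_holder φ f

/-! ### The Hardy space as a closed subspace of `L²(𝕋)` -/

/-- `H²`, identified with the closed subspace of those `f ∈ L²(𝕋)` whose Fourier coefficients
of negative index all vanish. -/
def hardy : Submodule ℂ L2 where
  carrier := {f | ∀ n : ℤ, n < 0 → fourierCoeff (f : Torus → ℂ) n = 0}
  zero_mem' := by
    intro n _
    rw [← fourierBasis_repr]
    simp
  add_mem' := by
    intro f g hf hg n hn
    have h1 := hf n hn
    have h2 := hg n hn
    rw [← fourierBasis_repr] at h1 h2 ⊢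
    simp [h1, h2]
  smul_mem' := by
    intro c f hf n hn
    have h1 := hf n hn
    rw [← fourierBasis_repr] at h1 ⊢
    simp [h1]

theorem isClosed_hardy : IsClosed (hardy : Set L2) := by
  have h : (hardy : Set L2) = ⋂ n : ℤ, ⋂ _ : n < 0,
      {f : L2 | inner ℂ (fourierBasis (T := 2 * Real.pi) n) f = 0} := by
    ext f
    simp only [Set.mem_iInter, Set.mem_ofPred_eq, ← HilbertBasis.repr_apply_apply,
      fourierBasis_repr]
    rfl
  rw [h]
  exact isClosed_iInter fun n => isClosed_iInter fun _ =>
    isClosed_eq (by fun_prop) continuous_const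

/-! ### Inner functions on the disc -/

/-- The open unit disc `𝔻`. -/
abbrev disc : Set ℂ := Metric.ball 0 1

/-- `f`, restricted to `𝔻`, is in `H^∞`: it is bounded and analytic on `𝔻`. -/
def IsHInf (f : ℂ → ℂ) : Prop :=
  DifferentiableOn ℂ f disc ∧ ∃ C : ℝ, ∀ z ∈ disc, ‖f z‖ ≤ C

/-- `f` has the radial limit `w` at the point `exp (i t)` of the circle. -/
def HasRadialLimit (f : ℂ → ℂ) (t : Torus) (w : ℂ) : Prop :=
  Tendsto (fun r : ℝ => f ((r : ℂ) * (AddCircle.toCircle t : ℂ))) (𝓝[<] 1) (𝓝 w)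

/-- An inner function: a bounded analytic function on `𝔻` whose radial limits have modulus one
at almost every point of the circle. (Only the values of `f` on `𝔻` matter.) -/
structure IsInner (f : ℂ → ℂ) : Prop where
  isHInf : IsHInf f
  unimodular : ∀ᵐ t ∂torusMeasure, ∃ w : ℂ, HasRadialLimit f t w ∧ ‖w‖ = 1

/-- `f` is constant on `𝔻`. -/
def IsConstOnDisc (f : ℂ → ℂ) : Prop := ∃ c : ℂ, ∀ z ∈ disc, f z = c

/-- For inner functions `u`, `v`: `u` divides `v`, i.e. `v = u w` on `𝔻` for an inner `w`. -/
def InnerDvd (u v : ℂ → ℂ) : Prop :=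
  ∃ w : ℂ → ℂ, IsInner w ∧ ∀ z ∈ disc, v z = u z * w z

/-- The boundary function: at `t` the radial limit of `f` at `exp (i t)`, where it exists. -/
def boundaryFun (f : ℂ → ℂ) (t : Torus) : ℂ :=
  limUnder (𝓝[<] (1 : ℝ)) fun r : ℝ => f ((r : ℂ) * (AddCircle.toCircle t : ℂ))

theorem HasRadialLimit.boundaryFun_eq {f : ℂ → ℂ} {t : Torus} {w : ℂ}
    (h : HasRadialLimit f t w) : boundaryFun f t = w :=
  Tendsto.limUnder_eq h

theorem IsInner.memLp_boundaryFun {f : ℂ → ℂ} (hf : IsInner f) :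
    MemLp (boundaryFun f) ∞ torusMeasure := by
  obtain ⟨r, -, hr, hr1⟩ := exists_seq_strictMono_tendsto' (show (0 : ℝ) < 1 by norm_num)
  have hcont : ∀ n, Continuous fun t : Torus => f ((r n : ℂ) * (AddCircle.toCircle t : ℂ)) := by
    intro n
    refine hf.isHInf.1.continuousOn.comp_continuous
      (continuous_const.mul (continuous_subtype_val.comp AddCircle.continuous_toCircle)) ?_
    intro t
    have h := hr n
    simp only [mem_ball_zero_iff, norm_mul, Circle.norm_coe, mul_one, Complex.norm_real,
      Real.norm_eq_abs]
    rw [abs_of_pos h.1]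
    exact h.2
  have hr2 : Tendsto r atTop (𝓝[<] 1) :=
    tendsto_nhdsWithin_iff.2 ⟨hr1, Eventually.of_forall fun n => (hr n).2⟩
  refine memLp_top_of_bound (aestronglyMeasurable_of_tendsto_ae atTop
    (fun n => (hcont n).aestronglyMeasurable) ?_) 1 ?_
  · filter_upwards [hf.unimodular] with t ⟨w, hw, _⟩
    rw [hw.boundaryFun_eq]
    exact hw.comp hr2
  · filter_upwards [hf.unimodular] with t ⟨w, hw, h1⟩
    rw [hw.boundaryFun_eq, h1]

/-- The boundary function of an inner function, as an element of `L^∞(𝕋)`. -/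
def IsInner.symbol {f : ℂ → ℂ} (hf : IsInner f) : LInf := hf.memLp_boundaryFun.toLp

/-! ### Model spaces and (dual) truncated Toeplitz operators -/

/-- The model space `K_θ = H² ⊖ θ H²`. Here `θ` is given by its boundary function. -/
def modelSpace (θ : LInf) : Submodule ℂ L2 :=
  hardy ⊓ (hardy.map (laurent θ : L2 →ₗ[ℂ] L2))ᗮ

instance instCompleteSpaceModelSpace (θ : LInf) : CompleteSpace (modelSpace θ) :=
  (isClosed_hardy.inter (Submodule.isClosed_orthogonal _)).completeSpace_coe

/-- The truncated Toeplitz operator `A_φ f = P_θ (φ f)` on `K_θ`. -/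
def truncatedToeplitz (θ φ : LInf) : modelSpace θ →L[ℂ] modelSpace θ :=
  (modelSpace θ).orthogonalProjectionOnto ∘L laurent φ ∘L (modelSpace θ).subtypeL

/-- The dual truncated Toeplitz operator `D_φ f = Q_θ (φ f)` on `K_θ^⊥ = L²(𝕋) ⊖ K_θ`. -/
def dualTruncatedToeplitz (θ φ : LInf) : (modelSpace θ)ᗮ →L[ℂ] (modelSpace θ)ᗮ :=
  (modelSpace θ)ᗮ.orthogonalProjectionOnto ∘L laurent φ ∘L (modelSpace θ)ᗮ.subtypeL

/-- `T` is a partial isometry: `‖T h‖ = ‖h‖` for all `h` in the orthogonal complement of the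
null space of `T`. -/
def IsPartialIsometry {H : Type*} [NormedAddCommGroup H] [InnerProductSpace ℂ H]
    (T : H →L[ℂ] H) : Prop :=
  ∀ h ∈ (LinearMap.ker (T : H →ₗ[ℂ] H))ᗮ, ‖T h‖ = ‖h‖

end DualTTO

end

/-!
Write `P_K` for the orthogonal projection onto `K = K_θ`, `U` for multiplication by the boundary
function of `u`, a unitary operator on `L²(𝕋)`, and `F_v` for the projection onto `v H²`, where `v`
is inner. Both operators of the theorem are compressions of `U`, to `K` and to `Kᗮ`.

The compression of a unitary `U` to `K` is a partial isometry if and only if the projections onto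
`K` and `U K` commute (`isPartialIsometry_compression_iff_commute`). This condition does not change
when `K` is replaced by `Kᗮ`, so `D_u` and `A_u` are partial isometries simultaneously
(`isPartialIsometry_compression_orthogonal_iff`). Since `P_K = F_1 - F_θ` and the projection onto
`u K` is `F_u - F_{uθ}`, where `u θ H²` lies in both `u H²` and `θ H²`, the condition says exactly
that `F_θ` and `F_u` commute (`commute_starProjection_sub_iff`).

Inclusion of one of `θ H²`, `u H²` in the other makes the projections commute. Conversely, if they
commute and there is no inclusion, there are nonzero vectors `θ g ⊥ u H²` and `u f ⊥ θ H²` with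
`f, g ∈ H²`. Then `a = conj(u) θ g` and `b = conj(θ) u f` have only Fourier coefficients of negative
index, and `a b = f g`. Hence the coefficients of nonnegative index of `f g` vanish. They form the
product of the power series of `f` and `g`, and `ℂ⟦X⟧` has no zero divisors, so `f` or `g` is zero
(`eq_zero_or_eq_zero_of_mul_eq`).

Finally `θ H² ⊆ u H²` means that `u` divides `θ` (`innerDvd_iff_map_hardy_le`). Fourier coefficients
of boundary functions are Taylor coefficients, by dominated convergence. If `θ = u h` on the circle
with `h ∈ H²`, the analytic extension `w` of `h` satisfies `θ = u w` on the disc. It is bounded by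
`1`, because the powers of `h` are unit vectors of `H²` and so the powers of `w` are bounded at each
point, and its radial limits are quotients of those of `θ` and `u`; Fatou's theorem is not needed.
-/

noncomputable section

namespace DualTTO

/-! ### Compressions of unitary operators -/

section Compression

variable {E : Type*} [NormedAddCommGroup E] [InnerProductSpace ℂ E]

/-- Write `T = P U|_K` with `P` the projection onto `K`. If `T` is a partial isometry, then
`‖P U m‖ = ‖m‖ = ‖U m‖` for `m ∈ (ker T)ᗮ`, so `U m ∈ K`, while `U n ⊥ K` for `n ∈ ker T`: the
subspace `U K` splits into a part inside `K` and a part orthogonal to `K`, so the projections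
commute. Conversely, if they commute, then for `k ∈ K` the component of `U k` orthogonal to `K` is
`U n` with `n ∈ ker T`, and it vanishes as soon as `k ⊥ ker T`. -/
theorem isPartialIsometry_compression_iff_commute [CompleteSpace E] (U : E ≃ₗᵢ[ℂ] E)
    (K : Submodule ℂ E) [CompleteSpace K] :
    IsPartialIsometry (K.orthogonalProjectionOnto ∘L (U : E →L[ℂ] E) ∘L K.subtypeL) ↔
      Commute K.starProjection (K.map (U.toLinearEquiv : E →ₗ[ℂ] E)).starProjection := by
  set T : K →L[ℂ] K := K.orthogonalProjectionOnto ∘L (U : E →L[ℂ] E) ∘L K.subtypeL with hT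
  set L : Submodule ℂ E := K.map (U.toLinearEquiv : E →ₗ[ℂ] E) with hL
  have hTU : ∀ k : K, ((T k : K) : E) = K.starProjection (U k) := fun k => rfl
  have hUL : ∀ k : K, U k ∈ L := fun k => ⟨k, k.2, rfl⟩
  have hker : ∀ k : K, T k = 0 ↔ K.starProjection (U k) = 0 := by
    intro k
    rw [← hTU, ZeroMemClass.coe_eq_zero]
  constructor
  · intro h
    have hfix : ∀ x, L.starProjection (K.starProjection (L.starProjection x)) =
        K.starProjection (L.starProjection x) := by
      intro x
      obtain ⟨k, hk, hkx⟩ : L.starProjection x ∈ L := L.starProjection_apply_mem x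
      have : CompleteSpace (LinearMap.ker (T : K →ₗ[ℂ] K)) :=
        (ContinuousLinearMap.isClosed_ker T).completeSpace_coe
      obtain ⟨n, hn, m, hm, hnm⟩ :=
        (LinearMap.ker (T : K →ₗ[ℂ] K)).exists_add_mem_mem_orthogonal ⟨k, hk⟩
      have hn0 : K.starProjection (U n) = 0 := (hker n).1 hn
      have hmK : U m ∈ K := by
        rw [K.mem_iff_norm_starProjection, ← hTU, U.norm_map]
        exact h m hm
      have hx : L.starProjection x = U n + U m := by
        rw [← hkx, ← map_add, ← Submodule.coe_add, ← hnm]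
        rfl
      rw [hx, map_add, hn0, zero_add, K.starProjection_eq_self_iff.2 hmK,
        L.starProjection_eq_self_iff.2 (hUL m)]
    -- `L P L = P L` for the projections; taking adjoints gives `L P L = L P`.
    refine ContinuousLinearMap.ext fun x => ext_inner_right ℂ fun y => ?_
    simp only [mul_apply_eq_comp]
    rw [← hfix, L.inner_starProjection_left_eq_right, K.inner_starProjection_left_eq_right,
      L.inner_starProjection_left_eq_right, hfix, L.inner_starProjection_left_eq_right,
      K.inner_starProjection_left_eq_right]
  · intro h k hk
    have hc : ∀ x, K.starProjection (L.starProjection x) = L.starProjection (K.starProjection x) :=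
      fun x => DFunLike.congr_fun h x
    have hmem : U k - K.starProjection (U k) ∈ L := by
      rw [← L.starProjection_eq_self_iff, map_sub, ← hc, L.starProjection_eq_self_iff.2 (hUL k)]
    have horth := K.sub_starProjection_mem_orthogonal (U k)
    obtain ⟨n, hn, hUn⟩ := hmem
    have hUn' : U n = U k - K.starProjection (U k) := hUn
    have hn0 : T ⟨n, hn⟩ = 0 := by
      rw [hker]
      change K.starProjection (U n) = 0
      rw [hUn', K.starProjection_apply_eq_zero_iff]
      exact horth
    have h0 : inner ℂ (U n) (U k) = 0 := by
      rw [U.inner_map_map]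
      exact hk ⟨n, hn⟩ hn0
    rw [hUn'] at h0
    have h1 : inner ℂ (U k - K.starProjection (U k)) (U k - K.starProjection (U k)) = 0 := by
      rw [inner_sub_right, h0, K.starProjection_inner_eq_zero _ _ (K.starProjection_apply_mem _),
        sub_zero]
    rw [inner_self_eq_zero, sub_eq_zero] at h1
    rw [← Submodule.norm_coe, hTU, ← h1, U.norm_map, Submodule.norm_coe]

theorem starProjection_map_eq (U : E ≃ₗᵢ[ℂ] E) (K : Submodule ℂ E) [K.HasOrthogonalProjection] :
    (K.map (U.toLinearEquiv : E →ₗ[ℂ] E)).starProjection =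
      (U : E →L[ℂ] E) ∘L K.starProjection ∘L (U.symm : E →L[ℂ] E) :=
  ContinuousLinearMap.ext fun x => Submodule.starProjection_map_apply U K x

theorem starProjection_map_orthogonal (U : E ≃ₗᵢ[ℂ] E) (K : Submodule ℂ E)
    [K.HasOrthogonalProjection] :
    (Kᗮ.map (U.toLinearEquiv : E →ₗ[ℂ] E)).starProjection =
      1 - (K.map (U.toLinearEquiv : E →ₗ[ℂ] E)).starProjection := by
  ext x
  simp [starProjection_map_eq, Submodule.starProjection_orthogonal']

/-- Replacing both projections by their complements does not affect whether they commute, so a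
unitary has a partially isometric compression to `K` exactly when it has one to `Kᗮ`. -/
theorem isPartialIsometry_compression_orthogonal_iff [CompleteSpace E] (U : E ≃ₗᵢ[ℂ] E)
    (K : Submodule ℂ E) [CompleteSpace K] :
    IsPartialIsometry (Kᗮ.orthogonalProjectionOnto ∘L (U : E →L[ℂ] E) ∘L Kᗮ.subtypeL) ↔
      IsPartialIsometry (K.orthogonalProjectionOnto ∘L (U : E →L[ℂ] E) ∘L K.subtypeL) := by
  rw [isPartialIsometry_compression_iff_commute, isPartialIsometry_compression_iff_commute,
    starProjection_map_orthogonal, Submodule.starProjection_orthogonal']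
  refine ⟨fun h => ?_, fun h => ?_⟩
  · simpa using (Commute.one_left _).sub_left ((Commute.one_right _).sub_right h)
  · exact (Commute.one_left _).sub_left ((Commute.one_right _).sub_right h)

/-- The projection onto `H ⊖ L`, for a subspace `L` of `H`. -/
theorem starProjection_inf_orthogonal {H L : Submodule ℂ E} [H.HasOrthogonalProjection]
    [L.HasOrthogonalProjection] [(H ⊓ Lᗮ).HasOrthogonalProjection] (h : L ≤ H) :
    (H ⊓ Lᗮ).starProjection = H.starProjection - L.starProjection := by
  refine ContinuousLinearMap.ext fun x => (Submodule.eq_starProjection_of_mem_of_inner_eq_zero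
    (Submodule.mem_inf.2 ⟨?_, ?_⟩) fun w hw => ?_)
  · exact H.sub_mem (H.starProjection_apply_mem x) (h (L.starProjection_apply_mem x))
  · rw [← Submodule.starProjection_apply_eq_zero_iff, sub_apply, map_sub,
      L.starProjection_eq_self_iff.2 (L.starProjection_apply_mem x), sub_eq_zero]
    exact DFunLike.congr_fun (Submodule.starProjection_comp_starProjection_of_le h) x
  · obtain ⟨hwH, hwL⟩ := Submodule.mem_inf.1 hw
    have h1 := H.starProjection_inner_eq_zero x w hwH
    have h2 := hwL _ (L.starProjection_apply_mem x)
    rw [sub_apply, sub_sub_eq_add_sub, add_sub_right_comm, inner_add_left,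
      h1, h2, add_zero]

theorem starProjection_mul_of_le {L M : Submodule ℂ E} [L.HasOrthogonalProjection]
    [M.HasOrthogonalProjection] (h : L ≤ M) :
    L.starProjection * M.starProjection = L.starProjection :=
  Submodule.starProjection_comp_starProjection_of_le h

theorem starProjection_mul_of_ge {L M : Submodule ℂ E} [L.HasOrthogonalProjection]
    [M.HasOrthogonalProjection] (h : L ≤ M) :
    M.starProjection * L.starProjection = L.starProjection :=
  ContinuousLinearMap.ext fun x => M.starProjection_eq_self_iff.2 (h (L.starProjection_apply_mem x))

theorem starProjection_commute_of_le {L M : Submodule ℂ E} [L.HasOrthogonalProjection]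
    [M.HasOrthogonalProjection] (h : L ≤ M) : Commute L.starProjection M.starProjection :=
  (starProjection_mul_of_le h).trans (starProjection_mul_of_ge h).symm

/-- For commuting unitaries `V`, `W` that map `H` into itself and `K = H ⊖ V H`, the projection
onto `W K` is the projection onto `W H` minus the one onto `W V H`. As `W V H` lies in both `V H`
and `W H`, all that remains of the commutator of the projections onto `K` and `W K` is the
commutator of those onto `V H` and `W H`. -/
theorem commute_starProjection_sub_iff (V W : E ≃ₗᵢ[ℂ] E) (hVW : ∀ x, V (W x) = W (V x))
    {H : Submodule ℂ E} [H.HasOrthogonalProjection]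
    (hV : H.map (V.toLinearEquiv : E →ₗ[ℂ] E) ≤ H) (hW : H.map (W.toLinearEquiv : E →ₗ[ℂ] E) ≤ H)
    [(H ⊓ (H.map (V.toLinearEquiv : E →ₗ[ℂ] E))ᗮ).HasOrthogonalProjection] :
    Commute (H ⊓ (H.map (V.toLinearEquiv : E →ₗ[ℂ] E))ᗮ).starProjection
        ((H ⊓ (H.map (V.toLinearEquiv : E →ₗ[ℂ] E))ᗮ).map
          (W.toLinearEquiv : E →ₗ[ℂ] E)).starProjection ↔
      Commute (H.map (V.toLinearEquiv : E →ₗ[ℂ] E)).starProjection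
        (H.map (W.toLinearEquiv : E →ₗ[ℂ] E)).starProjection := by
  set A := H.map (V.toLinearEquiv : E →ₗ[ℂ] E) with hA
  set B := H.map (W.toLinearEquiv : E →ₗ[ℂ] E) with hB
  set C := A.map (W.toLinearEquiv : E →ₗ[ℂ] E) with hC
  have hCA : C ≤ A := by
    rintro _ ⟨_, ⟨x, hx, rfl⟩, rfl⟩
    exact ⟨W x, hW ⟨x, hx, rfl⟩, hVW x⟩
  have hproj : ((H ⊓ Aᗮ).map (W.toLinearEquiv : E →ₗ[ℂ] E)).starProjection =
      B.starProjection - C.starProjection := by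
    ext x
    simp [hB, hC, starProjection_map_eq W, starProjection_inf_orthogonal hV]
  rw [hproj, starProjection_inf_orthogonal hV]
  have h1 : (H.starProjection - A.starProjection) * (B.starProjection - C.starProjection) =
      B.starProjection - A.starProjection * B.starProjection := by
    rw [sub_mul, mul_sub, mul_sub, starProjection_mul_of_ge hW,
      starProjection_mul_of_ge (hCA.trans hV), starProjection_mul_of_ge hCA]
    abel
  have h2 : (B.starProjection - C.starProjection) * (H.starProjection - A.starProjection) =
      B.starProjection - B.starProjection * A.starProjection := by
    rw [sub_mul, mul_sub, mul_sub, starProjection_mul_of_le hW,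
      starProjection_mul_of_le (hCA.trans hV), starProjection_mul_of_le hCA]
    abel
  rw [commute_iff_eq, h1, h2, sub_right_inj, commute_iff_eq]

/-- If the projections onto `L` and `M` commute, the component of a vector of `L` orthogonal to `M`
stays in `L`; so if neither subspace contains the other, then each contains a nonzero vector
orthogonal to the other. -/
theorem le_or_le_of_commute_starProjection {L M : Submodule ℂ E} [L.HasOrthogonalProjection]
    [M.HasOrthogonalProjection] (hc : Commute L.starProjection M.starProjection)
    (h : ∀ x ∈ L ⊓ Mᗮ, ∀ y ∈ M ⊓ Lᗮ, x = 0 ∨ y = 0) : L ≤ M ∨ M ≤ L := by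
  have key : ∀ {L M : Submodule ℂ E} [L.HasOrthogonalProjection] [M.HasOrthogonalProjection],
      Commute L.starProjection M.starProjection → ∀ x ∈ L, x - M.starProjection x ∈ L ⊓ Mᗮ := by
    intro L M _ _ hc x hx
    refine Submodule.mem_inf.2 ⟨L.sub_mem hx ?_, M.sub_starProjection_mem_orthogonal x⟩
    rw [← L.starProjection_eq_self_iff]
    refine (DFunLike.congr_fun hc x).trans ?_
    simp [L.starProjection_eq_self_iff.2 hx]
  by_contra! hne
  obtain ⟨x, hx, hxM⟩ := SetLike.not_le_iff_exists.1 hne.1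
  obtain ⟨y, hy, hyL⟩ := SetLike.not_le_iff_exists.1 hne.2
  rcases h _ (key hc x hx) _ (key hc.symm y hy) with h0 | h0
  · exact hxM (M.starProjection_eq_self_iff.1 (sub_eq_zero.1 h0).symm)
  · exact hyL (L.starProjection_eq_self_iff.1 (sub_eq_zero.1 h0).symm)

end Compression

/-! ### Fourier coefficients of products -/

theorem memLp_fourier_mul_star (f : L2) (n : ℤ) :
    MemLp (fun t => fourier n t * star ((f : Torus → ℂ) t)) 2 torusMeasure := by
  refine (Lp.memLp f).star.of_le ?_ ?_
  · exact ((fourier n).continuous.aestronglyMeasurable).mul (Lp.memLp f).star.1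
  · refine Eventually.of_forall fun t => ?_
    rw [norm_mul, fourier_apply, Circle.norm_coe, one_mul, Pi.star_apply]

/-- The Fourier coefficients of a product of two `L²` functions are the convolution of theirs:
Parseval's identity for `g` and `e_n conj(f)`. -/
theorem hasSum_fourierCoeff_mul (f g : L2) (n : ℤ) :
    HasSum (fun k => fourierCoeff (f : Torus → ℂ) (n - k) * fourierCoeff (g : Torus → ℂ) k)
      (fourierCoeff (fun t => (f : Torus → ℂ) t * (g : Torus → ℂ) t) n) := by
  have hx := (memLp_fourier_mul_star f n).coeFn_toLp
  have h := (fourierBasis (T := 2 * Real.pi)).hasSum_inner_mul_inner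
    (memLp_fourier_mul_star f n).toLp g
  convert! h using 1
  · ext k
    rw [← HilbertBasis.repr_apply_apply, fourierBasis_repr, L2.inner_def]
    congr 1
    refine integral_congr_ae ?_
    filter_upwards [hx, coeFn_fourierLp 2 k] with t ht hk
    rw [coe_fourierBasis, ht, hk, RCLike.inner_apply, smul_eq_mul, neg_sub, sub_eq_add_neg,
      fourier_add, fourier_neg, map_mul]
    simp [mul_assoc]
  · rw [L2.inner_def]
    refine integral_congr_ae ?_
    filter_upwards [hx] with t ht
    rw [ht, RCLike.inner_apply, smul_eq_mul, fourier_neg, map_mul]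
    simp
    ring

/-- The formal power series of the Fourier coefficients of nonnegative index. -/
def coeffSeries (f : Torus → ℂ) : PowerSeries ℂ := PowerSeries.mk fun n => fourierCoeff f n

theorem fourierCoeff_mul_hardy {f g : L2} (hf : f ∈ hardy) (hg : g ∈ hardy) (n : ℤ) :
    fourierCoeff (fun t => (f : Torus → ℂ) t * (g : Torus → ℂ) t) n =
      ∑ k ∈ Finset.Icc 0 n,
        fourierCoeff (f : Torus → ℂ) (n - k) * fourierCoeff (g : Torus → ℂ) k := by
  refine (hasSum_fourierCoeff_mul f g n).unique (hasSum_sum_of_ne_finset_zero fun k hk => ?_)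
  rw [Finset.mem_Icc, not_and_or, not_le, not_le] at hk
  rcases hk with hk | hk
  · rw [hg k hk, mul_zero]
  · rw [hf (n - k) (by omega), zero_mul]

theorem fourierCoeff_mul_hardy_of_neg {f g : L2} (hf : f ∈ hardy) (hg : g ∈ hardy) {n : ℤ}
    (hn : n < 0) : fourierCoeff (fun t => (f : Torus → ℂ) t * (g : Torus → ℂ) t) n = 0 := by
  rw [fourierCoeff_mul_hardy hf hg, Finset.Icc_eq_empty (by omega), Finset.sum_empty]

theorem coeffSeries_mul {f g : L2} (hf : f ∈ hardy) (hg : g ∈ hardy) :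
    coeffSeries (fun t => (f : Torus → ℂ) t * (g : Torus → ℂ) t) =
      coeffSeries f * coeffSeries g := by
  ext n
  rw [PowerSeries.coeff_mul, coeffSeries, PowerSeries.coeff_mk, fourierCoeff_mul_hardy hf hg]
  simp only [coeffSeries, PowerSeries.coeff_mk]
  symm
  refine Finset.sum_bij' (fun p _ => (p.2 : ℤ)) (fun k _ => (n - k.toNat, k.toNat)) ?_ ?_ ?_ ?_ ?_
  · rintro ⟨a, b⟩ h
    simp only [Finset.HasAntidiagonal.mem_antidiagonal, Finset.mem_Icc] at h ⊢
    omega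
  · intro k hk
    simp only [Finset.HasAntidiagonal.mem_antidiagonal, Finset.mem_Icc] at hk ⊢
    omega
  · rintro ⟨a, b⟩ h
    simp only [Finset.HasAntidiagonal.mem_antidiagonal, Prod.mk.injEq] at h ⊢
    omega
  · intro k hk
    simp only [Finset.mem_Icc] at hk ⊢
    omega
  · rintro ⟨a, b⟩ h
    simp only [Finset.HasAntidiagonal.mem_antidiagonal] at h ⊢
    rw [← h]
    simp

theorem coeffSeries_eq_zero_iff {f : L2} (hf : f ∈ hardy) : coeffSeries f = 0 ↔ f = 0 := by
  refine ⟨fun h => ?_, ?_⟩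
  · refine (fourierBasis (T := 2 * Real.pi)).repr.map_eq_zero_iff.1 (lp.ext (funext fun n => ?_))
    rw [fourierBasis_repr]
    rcases lt_or_ge n 0 with hn | hn
    · exact hf n hn
    · lift n to ℕ using hn
      simpa [coeffSeries] using congrArg (PowerSeries.coeff n) h
  · rintro rfl
    ext n
    rw [coeffSeries, PowerSeries.coeff_mk, ← fourierBasis_repr]
    simp

/-- If `f g = a b` with `f, g ∈ H²` and `a, b` having only Fourier coefficients of negative index,
then all coefficients of `f g` vanish and, formal power series having no zero divisors, `f` or `g`
is zero. -/
theorem eq_zero_or_eq_zero_of_mul_eq {f g a b : L2} (hf : f ∈ hardy) (hg : g ∈ hardy)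
    (ha : ∀ n : ℤ, 0 ≤ n → fourierCoeff (a : Torus → ℂ) n = 0)
    (hb : ∀ n : ℤ, 0 ≤ n → fourierCoeff (b : Torus → ℂ) n = 0)
    (h : ∀ᵐ t ∂torusMeasure, (f : Torus → ℂ) t * (g : Torus → ℂ) t =
      (a : Torus → ℂ) t * (b : Torus → ℂ) t) : f = 0 ∨ g = 0 := by
  rw [← coeffSeries_eq_zero_iff hf, ← coeffSeries_eq_zero_iff hg, ← mul_eq_zero,
    ← coeffSeries_mul hf hg]
  ext n
  rw [coeffSeries, PowerSeries.coeff_mk, fourierCoeff_congr_ae h, map_zero]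
  refine (hasSum_fourierCoeff_mul a b n).unique ?_
  convert! hasSum_zero using 2 with k
  rcases lt_or_ge k 0 with hk | hk
  · rw [ha (n - k) (by omega), zero_mul]
  · rw [hb k hk, mul_zero]

/-! ### Taylor coefficients and Fourier coefficients of inner functions -/

/-- The `n`-th Taylor coefficient of `f` at the origin. -/
def taylorCoeff (f : ℂ → ℂ) (n : ℕ) : ℂ := (n.factorial : ℂ)⁻¹ * iteratedDeriv n f 0

theorem hasSum_taylorCoeff {f : ℂ → ℂ} (hf : DifferentiableOn ℂ f disc) {z : ℂ} (hz : z ∈ disc) :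
    HasSum (fun n => taylorCoeff f n * z ^ n) (f z) := by
  convert! Complex.hasSum_taylorSeries_on_ball hf hz using 2 with n
  rw [taylorCoeff, sub_zero, smul_eq_mul, smul_eq_mul]
  ring

theorem radius_mul_toCircle_mem_disc {r : ℝ} (hr : r ∈ Set.Ioo 0 1) (t : Torus) :
    (r : ℂ) * (AddCircle.toCircle t : ℂ) ∈ disc := by
  rw [mem_ball_zero_iff, norm_mul, Circle.norm_coe, mul_one, Complex.norm_real, Real.norm_eq_abs,
    abs_of_pos hr.1]
  exact hr.2

theorem continuous_dilate {f : ℂ → ℂ} (hf : DifferentiableOn ℂ f disc) {r : ℝ}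
    (hr : r ∈ Set.Ioo 0 1) : Continuous fun t : Torus => f ((r : ℂ) * (AddCircle.toCircle t : ℂ)) :=
  hf.continuousOn.comp_continuous
    (continuous_const.mul (continuous_subtype_val.comp AddCircle.continuous_toCircle))
    (radius_mul_toCircle_mem_disc hr)

/-- The Fourier coefficients of `t ↦ f (r e^{it})`, by integrating the Taylor series termwise. -/
theorem hasSum_fourierCoeff_dilate {f : ℂ → ℂ} (hf : DifferentiableOn ℂ f disc) {r : ℝ}
    (hr : r ∈ Set.Ioo 0 1) (m : ℤ) :
    HasSum (fun n : ℕ => taylorCoeff f n * (r : ℂ) ^ n * (Pi.single (n : ℤ) 1 : ℤ → ℂ) m)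
      (fourierCoeff (fun t : Torus => f ((r : ℂ) * (AddCircle.toCircle t : ℂ))) m) := by
  have hsum : Summable fun n => ‖taylorCoeff f n * (r : ℂ) ^ n‖ := by
    have hz : (r : ℂ) ∈ disc := by
      simpa using radius_mul_toCircle_mem_disc hr 0
    exact (hasSum_taylorCoeff hf hz).summable.norm
  let F : ℕ → Torus → ℂ := fun n t =>
    fourier (-m) t * (taylorCoeff f n * (r : ℂ) ^ n * fourier (n : ℤ) t)
  have hFc : ∀ n, Continuous (F n) := fun n => by fun_prop
  have hFn : ∀ n t, ‖F n t‖ = ‖taylorCoeff f n * (r : ℂ) ^ n‖ := fun n t => by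
    simp only [F]
    rw [norm_mul, norm_mul _ (fourier (n : ℤ) t), fourier_apply, fourier_apply, Circle.norm_coe,
      Circle.norm_coe, one_mul, mul_one]
  have hint : ∀ n, Integrable (F n) torusMeasure := fun n =>
    .of_bound (hFc n).aestronglyMeasurable _ (Eventually.of_forall fun t => (hFn n t).le)
  have h := hasSum_integral_of_summable_integral_norm hint (by simpa [hFn] using hsum)
  convert! h using 1
  · ext n
    rw [← fourierCoeff_fourier (T := 2 * Real.pi), ← fourierCoeff.const_mul]
    rfl
  · refine integral_congr_ae (Eventually.of_forall fun t => ?_)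
    have h1 := (hasSum_taylorCoeff hf (radius_mul_toCircle_mem_disc hr t)).mul_left
      (fourier (-m) t : ℂ)
    refine h1.tsum_eq.symm.trans (tsum_congr fun n => ?_)
    simp only [F]
    rw [mul_pow, mul_assoc (taylorCoeff f n), fourier_apply (n := (n : ℤ)), natCast_zsmul,
      AddCircle.toCircle_nsmul, Circle.coe_pow]

theorem eventually_mem_Ioo_zero_one : ∀ᶠ r : ℝ in 𝓝[<] 1, r ∈ Set.Ioo (0 : ℝ) 1 :=
  Ioo_mem_nhdsLT zero_lt_one

theorem IsInner.hasRadialLimit_boundaryFun {f : ℂ → ℂ} (hf : IsInner f) :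
    ∀ᵐ t ∂torusMeasure, HasRadialLimit f t (boundaryFun f t) ∧ ‖boundaryFun f t‖ = 1 := by
  filter_upwards [hf.unimodular] with t ⟨w, hw, h1⟩
  rw [hw.boundaryFun_eq]
  exact ⟨hw, h1⟩

theorem IsInner.tendsto_fourierCoeff_dilate {f : ℂ → ℂ} (hf : IsInner f) (m : ℤ) :
    Tendsto (fun r : ℝ => fourierCoeff (fun t : Torus => f ((r : ℂ) * (AddCircle.toCircle t : ℂ))) m)
      (𝓝[<] 1) (𝓝 (fourierCoeff (boundaryFun f) m)) := by
  obtain ⟨C, hC⟩ := hf.isHInf.2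
  refine tendsto_integral_filter_of_dominated_convergence (fun _ => C) ?_ ?_
    (integrable_const _) ?_
  · filter_upwards [eventually_mem_Ioo_zero_one] with r hr
    exact ((fourier (-m)).continuous.smul (continuous_dilate hf.isHInf.1 hr)).aestronglyMeasurable
  · filter_upwards [eventually_mem_Ioo_zero_one] with r hr
    refine Eventually.of_forall fun t => ?_
    rw [norm_smul, fourier_apply, Circle.norm_coe, one_mul]
    exact hC _ (radius_mul_toCircle_mem_disc hr t)
  · filter_upwards [hf.hasRadialLimit_boundaryFun] with t ht
    exact ht.1.const_smul _

theorem IsInner.fourierCoeff_boundaryFun_of_neg {f : ℂ → ℂ} (hf : IsInner f) {m : ℤ} (hm : m < 0) :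
    fourierCoeff (boundaryFun f) m = 0 := by
  refine tendsto_nhds_unique (hf.tendsto_fourierCoeff_dilate m)
    (tendsto_const_nhds.congr' ?_)
  filter_upwards [eventually_mem_Ioo_zero_one] with r hr
  refine HasSum.unique ?_ (hasSum_fourierCoeff_dilate hf.isHInf.1 hr m)
  convert! hasSum_zero using 2 with n
  rw [Pi.single_eq_of_ne (by omega), mul_zero]

theorem IsInner.fourierCoeff_boundaryFun_natCast {f : ℂ → ℂ} (hf : IsInner f) (n : ℕ) :
    fourierCoeff (boundaryFun f) n = taylorCoeff f n := by
  have hlim : Tendsto (fun r : ℝ => taylorCoeff f n * (r : ℂ) ^ n) (𝓝[<] 1)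
      (𝓝 (taylorCoeff f n)) := by
    have : Continuous fun r : ℝ => taylorCoeff f n * (r : ℂ) ^ n := by fun_prop
    simpa using (this.tendsto 1).mono_left nhdsWithin_le_nhds
  refine tendsto_nhds_unique (hf.tendsto_fourierCoeff_dilate n) (hlim.congr' ?_)
  filter_upwards [eventually_mem_Ioo_zero_one] with r hr
  refine HasSum.unique ?_ (hasSum_fourierCoeff_dilate hf.isHInf.1 hr n)
  have h := hasSum_single (f := fun k : ℕ =>
    taylorCoeff f k * (r : ℂ) ^ k * (Pi.single (k : ℤ) 1 : ℤ → ℂ) n) n fun k hk => by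
      rw [Pi.single_eq_of_ne (by exact_mod_cast hk.symm), mul_zero]
  simpa using h

/-! ### Multiplication by a unimodular symbol -/

theorem laurent_comm (φ ψ : LInf) (f : L2) : laurent φ (laurent ψ f) = laurent ψ (laurent φ f) := by
  refine Lp.ext ?_
  filter_upwards [laurent_coeFn φ (laurent ψ f), laurent_coeFn ψ f, laurent_coeFn ψ (laurent φ f),
    laurent_coeFn φ f] with t h1 h2 h3 h4
  rw [h1, h2, h3, h4]
  ring

theorem norm_laurent_of_unimodular {φ : LInf} (hφ : ∀ᵐ t ∂torusMeasure, ‖φ t‖ = 1) (f : L2) :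
    ‖laurent φ f‖ = ‖f‖ := by
  rw [Lp.norm_def, Lp.norm_def]
  congr 1
  refine eLpNorm_congr_norm_ae ?_
  filter_upwards [laurent_coeFn φ f, hφ] with t h1 h2
  rw [h1, norm_mul, h2, one_mul]

/-- The unitary operator `f ↦ φ f` on `L²(𝕋)`, for a unimodular `φ`; its inverse is multiplication
by `conj(φ)`. -/
def unimodularMul (φ : LInf) (hφ : ∀ᵐ t ∂torusMeasure, ‖φ t‖ = 1) : L2 ≃ₗᵢ[ℂ] L2 :=
  LinearIsometryEquiv.ofSurjective ⟨(laurent φ : L2 →ₗ[ℂ] L2), norm_laurent_of_unimodular hφ⟩ <| by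
    intro g
    refine ⟨laurent (star φ) g, Lp.ext ?_⟩
    filter_upwards [laurent_coeFn φ (laurent (star φ) g), laurent_coeFn (star φ) g,
      Lp.coeFn_star φ, hφ] with t h1 h2 h3 h4
    refine h1.trans ?_
    rw [h2, h3, Pi.star_apply, ← mul_assoc, RCLike.star_def, RCLike.mul_conj, h4]
    simp

/-- The constant function `1` in `L²(𝕋)`. -/
def oneL2 : L2 := fourierLp 2 0

theorem oneL2_coeFn : oneL2 =ᵐ[torusMeasure] fun _ => 1 := by
  filter_upwards [coeFn_fourierLp (T := 2 * Real.pi) 2 0] with t ht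
  rw [oneL2, ht, fourier_zero]

theorem fourierLp_mem_hardy {n : ℤ} (hn : 0 ≤ n) : fourierLp 2 n ∈ hardy := by
  intro k hk
  rw [← fourierBasis_repr, ← coe_fourierBasis, HilbertBasis.repr_self, lp.single_apply_ne]
  omega

theorem oneL2_mem_hardy : oneL2 ∈ hardy := fourierLp_mem_hardy le_rfl

theorem laurent_oneL2_coeFn (φ : LInf) : laurent φ oneL2 =ᵐ[torusMeasure] φ := by
  filter_upwards [laurent_coeFn φ oneL2, oneL2_coeFn] with t h1 h2
  rw [h1, h2, mul_one]

/-- A bounded function in `H²` multiplies `H²` into itself. -/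
theorem laurent_mem_hardy {φ : LInf} (hφ : laurent φ oneL2 ∈ hardy) {f : L2} (hf : f ∈ hardy) :
    laurent φ f ∈ hardy := by
  intro n hn
  rw [← fourierCoeff_mul_hardy_of_neg hφ hf hn]
  refine congrFun (fourierCoeff_congr_ae ?_) n
  filter_upwards [laurent_coeFn φ f, laurent_oneL2_coeFn φ] with t h1 h2
  rw [h1, h2]

theorem coeffSeries_laurent {φ : LInf} (hφ : laurent φ oneL2 ∈ hardy) {f : L2} (hf : f ∈ hardy) :
    coeffSeries (laurent φ f) = coeffSeries (laurent φ oneL2) * coeffSeries f := by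
  rw [← coeffSeries_mul hφ hf]
  refine congrArg (fun c : ℤ → ℂ => PowerSeries.mk fun n : ℕ => c n) (fourierCoeff_congr_ae ?_)
  filter_upwards [laurent_coeFn φ f, laurent_oneL2_coeFn φ] with t h1 h2
  rw [h1, h2]

theorem IsInner.symbol_coeFn {f : ℂ → ℂ} (hf : IsInner f) :
    hf.symbol =ᵐ[torusMeasure] boundaryFun f := hf.memLp_boundaryFun.coeFn_toLp

theorem IsInner.norm_symbol {f : ℂ → ℂ} (hf : IsInner f) :
    ∀ᵐ t ∂torusMeasure, ‖hf.symbol t‖ = 1 := by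
  filter_upwards [hf.symbol_coeFn, hf.hasRadialLimit_boundaryFun] with t h1 h2
  rw [h1, h2.2]

theorem IsInner.fourierCoeff_symbol {f : ℂ → ℂ} (hf : IsInner f) :
    fourierCoeff (laurent hf.symbol oneL2 : Torus → ℂ) = fourierCoeff (boundaryFun f) :=
  fourierCoeff_congr_ae ((laurent_oneL2_coeFn _).trans hf.symbol_coeFn)

theorem IsInner.laurent_symbol_mem_hardy {f : ℂ → ℂ} (hf : IsInner f) :
    laurent hf.symbol oneL2 ∈ hardy := fun n hn => by
  rw [hf.fourierCoeff_symbol, hf.fourierCoeff_boundaryFun_of_neg hn]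

theorem IsInner.coeff_coeffSeries_symbol {f : ℂ → ℂ} (hf : IsInner f) (n : ℕ) :
    (coeffSeries (laurent hf.symbol oneL2)).coeff n = taylorCoeff f n := by
  rw [coeffSeries, PowerSeries.coeff_mk, hf.fourierCoeff_symbol,
    hf.fourierCoeff_boundaryFun_natCast]

/-! ### The analytic extension of a Hardy space function to the disc -/

/-- The sum `∑ a_n z^n` of the Fourier series over the nonnegative indices `n`; for `f ∈ H²` this
is the analytic extension of `f` to the disc. -/
def discExtension (f : L2) (z : ℂ) : ℂ := ∑' n, (coeffSeries f).coeff n * z ^ n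

theorem norm_coeff_coeffSeries_le (f : L2) (n : ℕ) : ‖(coeffSeries f).coeff n‖ ≤ ‖f‖ := by
  rw [coeffSeries, PowerSeries.coeff_mk, ← fourierBasis_repr,
    ← (fourierBasis (T := 2 * Real.pi)).repr.norm_map f]
  exact lp.norm_apply_le_norm two_ne_zero _ _

theorem norm_discExtension_term_le (f : L2) {z : ℂ} {r : ℝ} (hz : ‖z‖ ≤ r) (n : ℕ) :
    ‖(coeffSeries f).coeff n * z ^ n‖ ≤ ‖f‖ * r ^ n := by
  rw [norm_mul, norm_pow]
  gcongr
  exact norm_coeff_coeffSeries_le f n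

theorem summable_discExtension (f : L2) {z : ℂ} (hz : z ∈ disc) :
    Summable fun n => ‖(coeffSeries f).coeff n * z ^ n‖ :=
  ((summable_geometric_of_lt_one (norm_nonneg z) (mem_ball_zero_iff.1 hz)).mul_left
    ‖f‖).of_nonneg_of_le (fun _ => norm_nonneg _) (norm_discExtension_term_le f le_rfl)

theorem norm_discExtension_le (f : L2) {z : ℂ} (hz : z ∈ disc) :
    ‖discExtension f z‖ ≤ ‖f‖ * (1 - ‖z‖)⁻¹ :=
  tsum_of_norm_bounded ((hasSum_geometric_of_lt_one (norm_nonneg z)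
    (mem_ball_zero_iff.1 hz)).mul_left ‖f‖) (norm_discExtension_term_le f le_rfl)

theorem differentiableOn_discExtension (f : L2) : DifferentiableOn ℂ (discExtension f) disc := by
  intro z hz
  obtain ⟨r, hzr, hr1⟩ := exists_between (mem_ball_zero_iff.1 hz)
  have hr0 : 0 ≤ r := (norm_nonneg z).trans hzr.le
  have h := Complex.differentiableOn_tsum_of_summable_norm
    ((summable_geometric_of_lt_one hr0 hr1).mul_left ‖f‖)
    (F := fun n w => (coeffSeries f).coeff n * w ^ n) (U := Metric.ball 0 r)
    (fun n => by fun_prop) Metric.isOpen_ball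
    (fun n w hw => norm_discExtension_term_le f (mem_ball_zero_iff.1 hw).le n)
  exact ((h z (mem_ball_zero_iff.2 hzr)).differentiableAt
    (Metric.isOpen_ball.mem_nhds (mem_ball_zero_iff.2 hzr))).differentiableWithinAt

theorem discExtension_laurent {φ : LInf} (hφ : laurent φ oneL2 ∈ hardy) {f : L2} (hf : f ∈ hardy)
    {z : ℂ} (hz : z ∈ disc) :
    discExtension (laurent φ f) z = discExtension (laurent φ oneL2) z * discExtension f z := by
  unfold discExtension
  rw [tsum_mul_tsum_eq_tsum_sum_antidiagonal_of_summable_norm (summable_discExtension _ hz)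
    (summable_discExtension _ hz), coeffSeries_laurent hφ hf]
  refine tsum_congr fun n => ?_
  rw [PowerSeries.coeff_mul, Finset.sum_mul]
  refine Finset.sum_congr rfl fun p hp => ?_
  rw [← Finset.HasAntidiagonal.mem_antidiagonal.1 hp, pow_add]
  ring

theorem IsInner.discExtension_symbol {f : ℂ → ℂ} (hf : IsInner f) {z : ℂ} (hz : z ∈ disc) :
    discExtension (laurent hf.symbol oneL2) z = f z := by
  simp only [discExtension, hf.coeff_coeffSeries_symbol]
  exact (hasSum_taylorCoeff hf.isHInf.1 hz).tsum_eq

theorem coeffSeries_oneL2 : coeffSeries oneL2 = 1 := by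
  ext n
  rw [coeffSeries, PowerSeries.coeff_mk, ← fourierBasis_repr, oneL2, ← coe_fourierBasis,
    HilbertBasis.repr_self, lp.single_apply, PowerSeries.coeff_one]
  simp [Pi.single_apply]

theorem discExtension_oneL2 (z : ℂ) : discExtension oneL2 z = 1 := by
  rw [discExtension, coeffSeries_oneL2]
  refine (tsum_eq_single 0 fun n hn => ?_).trans (by simp)
  rw [PowerSeries.coeff_one, if_neg hn, zero_mul]

/-- All powers of a unimodular `φ ∈ H²` have norm one in `H²`, so that the powers of its analytic
extension at a given point are bounded. -/
theorem norm_discExtension_le_one {φ : LInf} (hφ : laurent φ oneL2 ∈ hardy)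
    (h1 : ∀ᵐ t ∂torusMeasure, ‖φ t‖ = 1) {z : ℂ} (hz : z ∈ disc) :
    ‖discExtension (laurent φ oneL2) z‖ ≤ 1 := by
  have hmem : ∀ m : ℕ, (laurent φ)^[m] oneL2 ∈ hardy := by
    intro m
    induction m with
    | zero => exact oneL2_mem_hardy
    | succ m ih => rw [Function.iterate_succ_apply']; exact laurent_mem_hardy hφ ih
  have hpow : ∀ m : ℕ, discExtension ((laurent φ)^[m] oneL2) z =
      discExtension (laurent φ oneL2) z ^ m := by
    intro m
    induction m with
    | zero => exact discExtension_oneL2 z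
    | succ m ih =>
      rw [Function.iterate_succ_apply', discExtension_laurent hφ (hmem m) hz, ih, pow_succ']
  have hnorm : ∀ m : ℕ, ‖(laurent φ)^[m] oneL2‖ = ‖oneL2‖ := by
    intro m
    induction m with
    | zero => rfl
    | succ m ih => rw [Function.iterate_succ_apply', norm_laurent_of_unimodular h1, ih]
  by_contra! hlt
  obtain ⟨m, hm⟩ := pow_unbounded_of_one_lt (‖oneL2‖ * (1 - ‖z‖)⁻¹) hlt
  have := norm_discExtension_le ((laurent φ)^[m] oneL2) hz
  rw [hpow, hnorm, norm_pow] at this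
  exact absurd this hm.not_ge

/-! ### Divisibility of inner functions and inclusion of Beurling subspaces -/

/-- On the disc the cofactor is the analytic extension `w` of the `H²` function `h`; its radial
limits exist because `w = v / u` near almost every boundary point, along the radius. -/
theorem innerDvd_of_laurent_eq {u v : ℂ → ℂ} (hu : IsInner u) (hv : IsInner v) {h : L2}
    (hh : h ∈ hardy) (huv : laurent hu.symbol h = laurent hv.symbol oneL2) : InnerDvd u v := by
  have hh1 : ∀ᵐ t ∂torusMeasure, ‖(h : Torus → ℂ) t‖ = 1 := by
    filter_upwards [laurent_coeFn hu.symbol h, laurent_oneL2_coeFn hv.symbol, hu.norm_symbol,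
      hv.norm_symbol] with t h1 h2 h3 h4
    have := congrArg norm ((congrArg (fun f : L2 => (f : Torus → ℂ) t) huv).symm.trans h1)
    rw [h2, h4, norm_mul, h3, one_mul] at this
    exact this.symm
  have hmem : MemLp (h : Torus → ℂ) ∞ torusMeasure :=
    memLp_top_of_bound (Lp.aestronglyMeasurable h) 1 (hh1.mono fun t ht => ht.le)
  set φ : LInf := hmem.toLp
  have hφh : laurent φ oneL2 = h := Lp.ext ((laurent_oneL2_coeFn φ).trans hmem.coeFn_toLp)
  have hφ1 : ∀ᵐ t ∂torusMeasure, ‖φ t‖ = 1 := by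
    filter_upwards [hmem.coeFn_toLp, hh1] with t h1 h2
    rw [h1, h2]
  have hφ : laurent φ oneL2 ∈ hardy := hφh ▸ hh
  have hprod : ∀ z ∈ disc, v z = u z * discExtension h z := by
    intro z hz
    rw [← hv.discExtension_symbol hz, ← huv,
      discExtension_laurent hu.laurent_symbol_mem_hardy hh hz, hu.discExtension_symbol hz]
  refine ⟨discExtension h, ⟨⟨differentiableOn_discExtension h, 1, fun z hz => ?_⟩, ?_⟩, hprod⟩
  · rw [← hφh]
    exact norm_discExtension_le_one hφ hφ1 hz
  · filter_upwards [hu.unimodular, hv.unimodular] with t ⟨a, ha, ha1⟩ ⟨b, hb, hb1⟩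
    have ha0 : a ≠ 0 := norm_ne_zero_iff.1 (by rw [ha1]; exact one_ne_zero)
    refine ⟨b / a, (hb.div ha ha0).congr' ?_, by rw [norm_div, ha1, hb1, div_one]⟩
    filter_upwards [eventually_mem_Ioo_zero_one, ha.eventually_ne ha0] with r hr hr0
    rw [Pi.div_apply, hprod _ (radius_mul_toCircle_mem_disc hr t), mul_div_cancel_left₀ _ hr0]

/-- Multiplication by the boundary function of an inner function, as a unitary on `L²(𝕋)`. -/
def IsInner.unitary {u : ℂ → ℂ} (hu : IsInner u) : L2 ≃ₗᵢ[ℂ] L2 :=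
  unimodularMul hu.symbol hu.norm_symbol

theorem IsInner.unitary_coeFn {u : ℂ → ℂ} (hu : IsInner u) (f : L2) :
    hu.unitary f =ᵐ[torusMeasure] fun t => hu.symbol t * f t :=
  laurent_coeFn hu.symbol f

theorem innerDvd_iff_map_hardy_le {u v : ℂ → ℂ} (hu : IsInner u) (hv : IsInner v) :
    InnerDvd u v ↔
      hardy.map (hv.unitary.toLinearEquiv : L2 →ₗ[ℂ] L2) ≤
        hardy.map (hu.unitary.toLinearEquiv : L2 →ₗ[ℂ] L2) := by
  constructor
  · rintro ⟨w, hw, huw⟩ _ ⟨f, hf, rfl⟩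
    refine ⟨laurent hw.symbol f, laurent_mem_hardy hw.laurent_symbol_mem_hardy hf, Lp.ext ?_⟩
    refine (laurent_coeFn hu.symbol (laurent hw.symbol f)).trans ?_
    refine EventuallyEq.trans ?_ (laurent_coeFn hv.symbol f).symm
    filter_upwards [laurent_coeFn hw.symbol f, hu.symbol_coeFn, hv.symbol_coeFn, hw.symbol_coeFn,
      hu.hasRadialLimit_boundaryFun, hw.hasRadialLimit_boundaryFun] with t h1 h2 h3 h4 h5 h6
    have hlim : HasRadialLimit v t (boundaryFun u t * boundaryFun w t) := by
      refine (h5.1.mul h6.1).congr' ?_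
      filter_upwards [eventually_mem_Ioo_zero_one] with r hr
      exact (huw _ (radius_mul_toCircle_mem_disc hr t)).symm
    rw [h1, h2, h3, h4, hlim.boundaryFun_eq, mul_assoc]
  · intro hle
    obtain ⟨h, hh, huv⟩ := hle ⟨oneL2, oneL2_mem_hardy, rfl⟩
    exact innerDvd_of_laurent_eq hu hv hh huv

/-! ### Commuting projections onto Beurling subspaces -/

theorem IsInner.map_unitary_hardy_le {u : ℂ → ℂ} (hu : IsInner u) :
    hardy.map (hu.unitary.toLinearEquiv : L2 →ₗ[ℂ] L2) ≤ hardy := by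
  rintro _ ⟨f, hf, rfl⟩
  exact laurent_mem_hardy hu.laurent_symbol_mem_hardy hf

instance instCompleteSpaceHardy : CompleteSpace hardy := isClosed_hardy.completeSpace_coe

theorem IsInner.fourierCoeff_unitary_symm {u : ℂ → ℂ} (hu : IsInner u) {x : L2}
    (hx : x ∈ (hardy.map (hu.unitary.toLinearEquiv : L2 →ₗ[ℂ] L2))ᗮ) (n : ℤ) (hn : 0 ≤ n) :
    fourierCoeff (hu.unitary.symm x : Torus → ℂ) n = 0 := by
  rw [← fourierBasis_repr, HilbertBasis.repr_apply_apply, coe_fourierBasis,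
    ← hu.unitary.inner_map_map, LinearIsometryEquiv.apply_symm_apply]
  exact hx _ ⟨_, fourierLp_mem_hardy hn, rfl⟩

/-- If `x = v g` is orthogonal to `u H²` and `y = u f` is orthogonal to `v H²`, then
`conj(u) v g` and `conj(v) u f` have no Fourier coefficients of nonnegative index, and their product is `f g`. -/
theorem eq_zero_or_eq_zero_of_orthogonal {u v : ℂ → ℂ} (hu : IsInner u) (hv : IsInner v) {x y : L2}
    (hx : x ∈ hardy.map (hv.unitary.toLinearEquiv : L2 →ₗ[ℂ] L2) ⊓
      (hardy.map (hu.unitary.toLinearEquiv : L2 →ₗ[ℂ] L2))ᗮ)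
    (hy : y ∈ hardy.map (hu.unitary.toLinearEquiv : L2 →ₗ[ℂ] L2) ⊓
      (hardy.map (hv.unitary.toLinearEquiv : L2 →ₗ[ℂ] L2))ᗮ) : x = 0 ∨ y = 0 := by
  obtain ⟨⟨g, hg, hgx⟩, hxu⟩ := Submodule.mem_inf.1 hx
  obtain ⟨⟨f, hf, hfy⟩, hyv⟩ := Submodule.mem_inf.1 hy
  have hgx : hv.unitary g = x := hgx
  have hfy : hu.unitary f = y := hfy
  have hmul : ∀ᵐ t ∂torusMeasure, (g : Torus → ℂ) t * (f : Torus → ℂ) t =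
      (hu.unitary.symm x : Torus → ℂ) t * (hv.unitary.symm y : Torus → ℂ) t := by
    have h1 := hu.unitary_coeFn (hu.unitary.symm x)
    have h2 := hv.unitary_coeFn (hv.unitary.symm y)
    rw [LinearIsometryEquiv.apply_symm_apply, ← hgx] at h1
    rw [LinearIsometryEquiv.apply_symm_apply, ← hfy] at h2
    rw [← hgx, ← hfy]
    filter_upwards [h1, h2, hv.unitary_coeFn g, hu.unitary_coeFn f, hu.norm_symbol,
      hv.norm_symbol] with t h1 h2 h3 h4 h5 h6
    have hu0 : hu.symbol t ≠ 0 := norm_ne_zero_iff.1 (by rw [h5]; exact one_ne_zero)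
    have hv0 : hv.symbol t ≠ 0 := norm_ne_zero_iff.1 (by rw [h6]; exact one_ne_zero)
    refine mul_left_cancel₀ (mul_ne_zero hu0 hv0) ?_
    rw [mul_mul_mul_comm, mul_comm (hu.symbol t * _), mul_mul_mul_comm (hu.symbol t) (hv.symbol t),
      ← h1, ← h2, h3, h4]
    ring
  rcases eq_zero_or_eq_zero_of_mul_eq hg hf (hu.fourierCoeff_unitary_symm hxu)
    (hv.fourierCoeff_unitary_symm hyv) hmul with h0 | h0
  · left
    rw [← hgx, h0, map_zero]
  · right
    rw [← hfy, h0, map_zero]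

theorem commute_starProjection_map_hardy_iff {u v : ℂ → ℂ} (hu : IsInner u) (hv : IsInner v) :
    Commute (hardy.map (hv.unitary.toLinearEquiv : L2 →ₗ[ℂ] L2)).starProjection
        (hardy.map (hu.unitary.toLinearEquiv : L2 →ₗ[ℂ] L2)).starProjection ↔
      InnerDvd u v ∨ InnerDvd v u := by
  rw [innerDvd_iff_map_hardy_le hu hv, innerDvd_iff_map_hardy_le hv hu]
  constructor
  · intro h
    exact le_or_le_of_commute_starProjection h fun x hx y hy =>
      eq_zero_or_eq_zero_of_orthogonal hu hv hx hy
  · rintro (h | h)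
    · exact starProjection_commute_of_le h
    · exact (starProjection_commute_of_le h).symm

theorem isPartialIsometry_truncatedToeplitz_iff {θ u : ℂ → ℂ} (hθ : IsInner θ) (hu : IsInner u) :
    IsPartialIsometry (truncatedToeplitz hθ.symbol hu.symbol) ↔ InnerDvd u θ ∨ InnerDvd θ u := by
  refine (isPartialIsometry_compression_iff_commute hu.unitary (modelSpace hθ.symbol)).trans ?_
  rw [← commute_starProjection_map_hardy_iff hu hθ]
  have : (hardy ⊓ (hardy.map (hθ.unitary.toLinearEquiv : L2 →ₗ[ℂ] L2))ᗮ).HasOrthogonalProjection :=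
    inferInstanceAs (modelSpace hθ.symbol).HasOrthogonalProjection
  exact commute_starProjection_sub_iff hθ.unitary hu.unitary (laurent_comm _ _)
    hθ.map_unitary_hardy_le hu.map_unitary_hardy_le

theorem isPartialIsometry_dualTruncatedToeplitz_iff {θ u : ℂ → ℂ} (hθ : IsInner θ)
    (hu : IsInner u) :
    IsPartialIsometry (dualTruncatedToeplitz hθ.symbol hu.symbol) ↔
      IsPartialIsometry (truncatedToeplitz hθ.symbol hu.symbol) :=
  isPartialIsometry_compression_orthogonal_iff hu.unitary (modelSpace hθ.symbol)

end DualTTO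

end

theorem mainTheorem1 (θ u : ℂ → ℂ) (hθ : DualTTO.IsInner θ)
    (hθc : ¬ DualTTO.IsConstOnDisc θ) (hu : DualTTO.IsInner u) :
    (DualTTO.IsPartialIsometry (DualTTO.dualTruncatedToeplitz hθ.symbol hu.symbol) ↔
      DualTTO.InnerDvd u θ ∨ DualTTO.InnerDvd θ u) ∧
    (DualTTO.IsPartialIsometry (DualTTO.truncatedToeplitz hθ.symbol hu.symbol) ↔
      DualTTO.InnerDvd u θ ∨ DualTTO.InnerDvd θ u) :=
  ⟨(DualTTO.isPartialIsometry_dualTruncatedToeplitz_iff hθ hu).trans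
      (DualTTO.isPartialIsometry_truncatedToeplitz_iff hθ hu),
    DualTTO.isPartialIsometry_truncatedToeplitz_iff hθ hu⟩
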